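/- Let $N\ge 13$. For $0\le m\le N$ let $|D^N_m\rangle=\binom{N}{m}^{-1/2}\sum_{x}|x\rangle$ be the $N$-qubit Dicke state, where $x$ runs over the elements of $\{0,1\}^N$ with exactly $m$ ones. Then there is a constant $K>0$ (depending only on $N$) such that for all $a,b,c\in\mathbb C$ with $b\ne 0$, $$|a|^2=\frac{\binom{N-4}{5}\,N(N-3)}{30\binom{N}{7}}\,|b|^2\qquad\text{and}\qquad |c|\ge K\max(|a|,|b|),$$ the pure state with (not necessarily normalized) state vector $$|\psi\rangle=a|D^N_1\rangle+b|D^N_7\rangle+c|D^N_N\rangle ,$$ i.e. the density operator $\rho=|\psi\rangle\langle\psi|/\langle\psi|\psi\rangle$, is strong $(N-5)$-resistant. That is: $\rho$ is genuinely entangled; for every set $J$ of $N-5$ qubits the $5$-qubit reduction $\mathrm{Tr}_J\,\rho$ is genuinely entangled; and for every set $J$ of $N-4$ qubits the $4$-qubit reduction $\mathrm{Tr}_J\,\rho$ is fully separable. Here a state (a positive semidefinite operator of trace one) of a finite set of qubits is fully separable if it is a finite convex combination of projectors $\bigotimes_i|v_i\rangle\langle v_i|$ onto product vectors with unit factors $v_i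 \in\mathbb C^2$. It is genuinely entangled if it is not a finite convex combination of states $\sigma_S\otimes\tau_{\bar S}$, each a product of two states across some partition $S|\bar S$ of the qubits into two nonempty parts (the partition may differ from term to term). -/

import Mathlib

namespace QubitStates

open scoped ComplexOrder

/-- Vectors of the Hilbert space `⨂_{i ∈ ι} ℂ²`, written in the computational basis `|x⟩`,
`x : ι → {0, 1}`; the finite type `ι` labels the particles. -/
abbrev QVec (ι : Type*) := (ι → Fin 2) → ℂ

/-- Operators on `⨂_{i ∈ ι} ℂ²`, as matrices in the computational basis. -/
abbrev QOp (ι : Type*) := Matrix (ι → Fin 2) (ι → Fin 2) ℂ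

section General

variable {ι : Type*} [Fintype ι] [DecidableEq ι]

/-- Density operators: positive semidefinite of trace one. -/
def IsDensity (ρ : QOp ι) : Prop := ρ.PosSemidef ∧ ρ.trace = 1

/-- The density operator `|ψ⟩⟨ψ| / ⟨ψ|ψ⟩` of the pure state spanned by a nonzero vector `ψ`
(equal to `|ψ⟩⟨ψ|` when `ψ` is a unit vector). -/
noncomputable def pureState (ψ : QVec ι) : QOp ι :=
  Matrix.of fun x y => ψ x * star (ψ y) / ((∑ z, ‖ψ z‖ ^ 2 : ℝ) : ℂ)

/-- The configuration of all particles that agrees with `z` on `J` and with `x` off `J`. -/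
def glue (J : Finset ι) (x : {i // i ∉ J} → Fin 2) (z : {i // i ∈ J} → Fin 2) : ι → Fin 2 :=
  fun i => if h : i ∈ J then z ⟨i, h⟩ else x ⟨i, h⟩

/-- The partial trace `Tr_J` over the particles in `J`; an operator on the particles outside `J`. -/
noncomputable def partialTrace (J : Finset ι) (ρ : QOp ι) : QOp {i // i ∉ J} :=
  Matrix.of fun x y => ∑ z : {i // i ∈ J} → Fin 2, ρ (glue J x z) (glue J y z)

/-- The pure product vector `⨂_i |v i⟩`. -/
noncomputable def productVec (v : ι → Fin 2 → ℂ) : QVec ι := fun x => ∏ i, v i (x i)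

/-- The projectors `⨂_i |v i⟩⟨v i|` onto fully product pure states (all `v i` unit vectors). -/
def productStates (ι : Type*) [Fintype ι] [DecidableEq ι] : Set (QOp ι) :=
  {R | ∃ v : ι → Fin 2 → ℂ, (∀ i, ∑ s, ‖v i s‖ ^ 2 = 1) ∧
    R = Matrix.of fun x y => productVec v x * star (productVec v y)}

/-- Fully separable: a (finite) convex combination of fully product pure states. -/
def FullySeparable (ρ : QOp ι) : Prop := ρ ∈ convexHull ℝ (productStates ι)

/-- The product operator `σ ⊗ τ`, with `σ` acting on the particles in `S` and `τ` on the others. -/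
def tensorAcross (S : Finset ι) (σ : QOp {i // i ∈ S}) (τ : QOp {i // i ∉ S}) : QOp ι :=
  Matrix.of fun x y =>
    σ (fun i => x i.1) (fun i => y i.1) * τ (fun i => x i.1) (fun i => y i.1)

/-- The states `σ ⊗ τ` that are products across some bipartition `S | Sᶜ` into nonempty parts. -/
def bipartiteProductStates (ι : Type*) [Fintype ι] [DecidableEq ι] : Set (QOp ι) :=
  {R | ∃ S : Finset ι, S.Nonempty ∧ Sᶜ.Nonempty ∧
    ∃ (σ : QOp {i // i ∈ S}) (τ : QOp {i // i ∉ S}),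
      IsDensity σ ∧ IsDensity τ ∧ R = tensorAcross S σ τ}

/-- Biseparable: a (finite) convex combination of states, each of which is a product across some
bipartition; the bipartition may vary from term to term. -/
def Biseparable (ρ : QOp ι) : Prop := ρ ∈ convexHull ℝ (bipartiteProductStates ι)

/-- Genuinely (multipartite) entangled: a state that is not biseparable. -/
def GenuinelyEntangled (ρ : QOp ι) : Prop := IsDensity ρ ∧ ¬ Biseparable ρ

/-- The pure state of `ψ` is strong `m`-resistant: it is genuinely entangled, it stays genuinely
entangled after the loss of any `m` particles, and it becomes fully separable after the loss of
any `m + 1` particles. -/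
def StrongResistant (m : ℕ) (ψ : QVec ι) : Prop :=
  GenuinelyEntangled (pureState ψ) ∧
  (∀ J : Finset ι, J.card = m → GenuinelyEntangled (partialTrace J (pureState ψ))) ∧
  (∀ J : Finset ι, J.card = m + 1 → FullySeparable (partialTrace J (pureState ψ)))

end General

/-- The Dicke state `|D^N_m⟩`: the uniform superposition, with amplitude `1 / √(N choose m)`, of the
basis vectors with exactly `m` particles in state `1`. -/
noncomputable def dicke (N m : ℕ) : QVec (Fin N) := fun x =>
  if (Finset.univ.filter fun i => x i = 1).card = m
  then ((1 / Real.sqrt (N.choose m) : ℝ) : ℂ) else 0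

end QubitStates

/-! The three weights 1, 7 and N differ pairwise by at least 6, since N ≥ 13. After tracing out all
but at most 5 qubits, every coherence between different weights therefore vanishes, and the
reduction is diagonal in the Dicke basis, with entries p k depending only on the weight k.

Genuine entanglement comes from `Biseparable.diag_sq_le`. If a biseparable state is symmetric, so is
each of its product terms; such a term satisfies p m * p (m+2) = p (m+1)^2, and Cauchy–Schwarz
leaves an inequality ≥ for the mixture. The full state violates it because p 6 = 0 and p 7 > 0. The
5-qubit reductions violate it because p 2, p 3, p 4 are proportional to consecutive binomial
coefficients, which are strictly log-concave.

Full separability comes from `fullySeparable_dickeDiagonal`: a geometric sequence is a phase average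
of product states, and surplus at either end is a multiple of |0…0⟩ or |1…1⟩. In the 4-qubit
reductions the prescribed |a| makes p 1, p 2, p 3 geometric and p 0 large enough, while a large |c|
lifts p 4. -/

namespace QubitStates

open scoped ComplexOrder

/-! ### Weights of basis strings. -/

section Symmetric

variable {ι : Type*} [Fintype ι] [DecidableEq ι]

/-- The number of particles in state `1`. -/
def wt (x : ι → Fin 2) : ℕ := (Finset.univ.filter fun i => x i = 1).card

theorem wt_eq_sum (x : ι → Fin 2) : wt x = ∑ i, (x i : ℕ) := by
  rw [wt, Finset.card_filter]
  refine Finset.sum_congr rfl fun i _ => ?_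
  generalize x i = s
  fin_cases s <;> simp

theorem wt_le_card (x : ι → Fin 2) : wt x ≤ Fintype.card ι := Finset.card_le_univ _

theorem wt_glue (J : Finset ι) (x : {i // i ∉ J} → Fin 2) (z : {i // i ∈ J} → Fin 2) :
    wt (glue J x z) = wt x + wt z := by
  simp only [wt_eq_sum]
  rw [← Fintype.sum_subtype_add_sum_subtype (fun i => i ∈ J), add_comm]
  congr 1
  · exact Fintype.sum_congr _ _ fun i => by simp [glue, i.2]
  · have h : ∀ i : {i // i ∈ J}, (glue J x z i : ℕ) = z i := fun i => by simp [glue, i.2]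
    simp only [h]
    congr!

theorem exists_wt_eq {k : ℕ} (s : Finset ι) (hk : k ≤ s.card) :
    ∃ x : ι → Fin 2, wt x = k ∧ ∀ i ∉ s, x i = 0 := by
  obtain ⟨t, hts, ht⟩ := Finset.exists_subset_card_eq hk
  refine ⟨fun i => if i ∈ t then 1 else 0, ?_, fun i hi => ?_⟩
  · simp [wt, ht]
  · exact if_neg fun h => hi (hts h)

theorem sum_comp_wt {M : Type*} [AddCommMonoid M] (F : ℕ → M) :
    ∑ z : ι → Fin 2, F (wt z) =
      ∑ j ∈ Finset.range (Fintype.card ι + 1), (Fintype.card ι).choose j • F j := by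
  rw [← Finset.card_univ, ← Finset.sum_powerset_apply_card]
  refine Finset.sum_nbij' (fun z => Finset.univ.filter fun i => z i = 1)
    (fun t i => if i ∈ t then 1 else 0) ?_ ?_ ?_ ?_ ?_
  · intro z _; simp
  · intro t _; simp
  · intro z _
    funext i
    simp only [Finset.mem_filter, Finset.mem_univ, true_and]
    generalize z i = s
    fin_cases s <;> simp
  · intro t _; ext i; simp
  · intro z _; rfl

theorem wt_update_zero {x : ι → Fin 2} {i : ι} (hi : x i = 0) :
    wt (Function.update x i 1) = wt x + 1 := by
  simp only [wt_eq_sum]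
  rw [← Finset.add_sum_erase _ _ (Finset.mem_univ i),
    ← Finset.add_sum_erase Finset.univ (fun j => (x j : ℕ)) (Finset.mem_univ i), hi]
  have : ∑ j ∈ Finset.univ.erase i, (Function.update x i 1 j : ℕ) =
      ∑ j ∈ Finset.univ.erase i, (x j : ℕ) :=
    Finset.sum_congr rfl fun j hj => by
      rw [Function.update_of_ne (Finset.ne_of_mem_erase hj)]
  rw [this]
  simp [add_comm]

/-! ### Density operators -/

theorem pureState_posSemidef (ψ : QVec ι) : (pureState ψ).PosSemidef := by
  have h : pureState ψ =
      (((∑ z, ‖ψ z‖ ^ 2 : ℝ)⁻¹ : ℝ) : ℂ) • Matrix.vecMulVec ψ (star ψ) := by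
    ext x y
    simp [pureState, Matrix.vecMulVec_apply, div_eq_inv_mul]
  rw [h]
  refine (Matrix.posSemidef_vecMulVec_self_star ψ).smul ?_
  rw [Complex.zero_le_real]
  positivity

theorem pureState_trace {ψ : QVec ι} (hψ : ψ ≠ 0) : (pureState ψ).trace = 1 := by
  have hpos : (∑ z, ‖ψ z‖ ^ 2 : ℝ) ≠ 0 := by
    intro h
    rw [Finset.sum_eq_zero_iff_of_nonneg fun _ _ => by positivity] at h
    exact hψ (funext fun x => by simpa using h x (Finset.mem_univ x))
  have hc : ((∑ z, ‖ψ z‖ ^ 2 : ℝ) : ℂ) ≠ 0 := by exact_mod_cast hpos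
  simp only [Matrix.trace, Matrix.diag, pureState, Matrix.of_apply]
  rw [← Finset.sum_div, div_eq_one_iff_eq hc]
  push_cast
  exact Finset.sum_congr rfl fun x _ => Complex.mul_conj' (ψ x)

theorem isDensity_pureState {ψ : QVec ι} (hψ : ψ ≠ 0) : IsDensity (pureState ψ) :=
  ⟨pureState_posSemidef ψ, pureState_trace hψ⟩

theorem isDensity_partialTrace (J : Finset ι) {ρ : QOp ι} (h : IsDensity ρ) :
    IsDensity (partialTrace J ρ) := by
  constructor
  · have : partialTrace J ρ = ∑ z, ρ.submatrix (fun x => glue J x z) (fun x => glue J x z) := by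
      ext x y
      simp [partialTrace, Matrix.sum_apply]
    rw [this]
    exact Matrix.posSemidef_sum _ fun z _ => h.1.submatrix _
  · rw [← h.2]
    simp only [Matrix.trace, Matrix.diag, partialTrace, Matrix.of_apply]
    rw [← Fintype.sum_prod_type', ← (Equiv.piEquivPiSubtypeProd (fun i => i ∈ J)
      (fun _ => Fin 2)).symm.sum_comp, ← (Equiv.prodComm _ _).sum_comp]
    rfl

theorem tensorAcross_posSemidef (S : Finset ι) {σ : QOp {i // i ∈ S}} {τ : QOp {i // i ∉ S}}
    (hσ : σ.PosSemidef) (hτ : τ.PosSemidef) : (tensorAcross S σ τ).PosSemidef := by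
  have h := (hσ.kronecker hτ).submatrix
    (fun x : ι → Fin 2 => ((fun i => x i.1 : {i // i ∈ S} → Fin 2),
      (fun i => x i.1 : {i // i ∉ S} → Fin 2)))
  exact h

/-! ### A separability criterion for symmetric states -/

/-- The hypothesis says that the quadratic form of R vanishes at e_x - e_y; by positivity this
vector lies in the kernel, so columns x and y coincide. -/
theorem posSemidef_diag_eq {n : Type*} [Fintype n] [DecidableEq n] {R : Matrix n n ℂ}
    (hR : R.PosSemidef) {x y : n} (h : R x x + R y y - R x y - R y x = 0) : R x x = R y y := by
  set v : n → ℂ := Pi.single x 1 - Pi.single y 1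
  have hv : R.mulVec v = 0 := by
    rw [← hR.dotProduct_mulVec_zero_iff]
    simp only [v, Matrix.mulVec_sub, Matrix.mulVec_single_one, star_sub, sub_dotProduct,
      dotProduct_sub, Pi.star_single, star_one, single_dotProduct, one_mul]
    simp only [Matrix.col_apply]
    linear_combination h
  have h1 := congrFun hv x
  have h2 := congrFun hv y
  simp only [v, Matrix.mulVec_sub, Matrix.mulVec_single_one, Pi.sub_apply, Matrix.col_apply,
    Pi.zero_apply] at h1 h2
  have hx := hR.1.apply x x
  have hxy := hR.1.apply y x
  rw [← hx, sub_eq_zero.1 h1, hxy, sub_eq_zero.1 h2]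

theorem posSemidef_quad_nonneg {n : Type*} [Fintype n] [DecidableEq n] {R : Matrix n n ℂ}
    (hR : R.PosSemidef) (x y : n) : 0 ≤ R x x + R y y - R x y - R y x := by
  have h := hR.dotProduct_mulVec_nonneg (Pi.single x 1 - Pi.single y 1)
  simp only [Matrix.mulVec_sub, Matrix.mulVec_single_one, star_sub, sub_dotProduct,
    dotProduct_sub, Pi.star_single, star_one, single_dotProduct, one_mul, Matrix.col_apply] at h
  convert h using 1
  ring

/-- Flipping i affects only the σ factor and flipping j only the τ factor, so both sides are
products of the same four numbers. -/
theorem tensorAcross_diag_mul (S : Finset ι) (σ : QOp {i // i ∈ S}) (τ : QOp {i // i ∉ S})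
    {i j : ι} (hi : i ∈ S) (hj : j ∉ S) (x : ι → Fin 2) :
    tensorAcross S σ τ x x *
      tensorAcross S σ τ (Function.update (Function.update x i 1) j 1)
        (Function.update (Function.update x i 1) j 1) =
    tensorAcross S σ τ (Function.update x i 1) (Function.update x i 1) *
      tensorAcross S σ τ (Function.update x j 1) (Function.update x j 1) := by
  have h1 : ∀ y : ι → Fin 2, (fun k : {k // k ∈ S} => Function.update y j 1 k.1) =
      fun k => y k.1 := fun y => funext fun k =>
    Function.update_of_ne (fun h : k.1 = j => hj (h ▸ k.2)) _ _
  have h2 : ∀ y : ι → Fin 2, (fun k : {k // k ∉ S} => Function.update y i 1 k.1) =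
      fun k => y k.1 := fun y => funext fun k =>
    Function.update_of_ne (fun h : k.1 = i => k.2 (h ▸ hi)) _ _
  have h3 : (fun k : {k // k ∉ S} => Function.update (Function.update x i 1) j 1 k.1) =
      fun k => Function.update x j 1 k.1 := by
    funext k
    by_cases hk : k.1 = j
    · simp [hk]
    · rw [Function.update_of_ne hk, Function.update_of_ne hk]
      exact congrFun (h2 x) k
  simp only [tensorAcross, Matrix.of_apply, h1, h2, h3]
  ring

/-- The diagonal of a biseparable state supported on the symmetric subspace is log-convex in the
number of particles in state `1`. -/
theorem Biseparable.diag_sq_le {ρ : QOp ι} (hρ : Biseparable ρ)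
    (hsym : ∀ x y, wt x = wt y → ρ x x + ρ y y - ρ x y - ρ y x = 0)
    {m : ℕ} (hm : m + 2 ≤ Fintype.card ι) {x₀ x₁ x₂ : ι → Fin 2}
    (h₀ : wt x₀ = m) (h₁ : wt x₁ = m + 1) (h₂ : wt x₂ = m + 2) :
    (ρ x₁ x₁).re ^ 2 ≤ (ρ x₀ x₀).re * (ρ x₂ x₂).re := by
  obtain ⟨κ, _, w, R, hw, -, hR, rfl⟩ := mem_convexHull_iff_exists_fintype.1 hρ
  have hpsd : ∀ k, (R k).PosSemidef := fun k => by
    obtain ⟨S, -, -, σ, τ, hσ, hτ, h⟩ := hR k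
    exact h ▸ tensorAcross_posSemidef S hσ.1 hτ.1
  -- The antisymmetric quadratic forms of the terms are nonnegative and their weighted sum is zero,
  -- so each term of positive weight inherits the symmetry.
  have hinv : ∀ k, w k ≠ 0 → ∀ x y, wt x = wt y → R k x x = R k y y := by
    intro k hk x y hxy
    refine posSemidef_diag_eq (hpsd k) ?_
    have hs := hsym x y hxy
    simp only [Matrix.sum_apply, Matrix.smul_apply, ← Finset.sum_add_distrib,
      ← Finset.sum_sub_distrib, ← smul_add, ← smul_sub] at hs
    rw [Finset.sum_eq_zero_iff_of_nonneg fun l _ =>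
      smul_nonneg (hw l) (posSemidef_quad_nonneg (hpsd l) x y)] at hs
    exact (smul_eq_zero.1 (hs k (Finset.mem_univ k))).resolve_left hk
  have hdiag : ∀ k x, R k x x = ((R k x x).re : ℂ) ∧ 0 ≤ (R k x x).re := fun k x => by
    have := (hpsd k).diag_nonneg (i := x)
    rw [Complex.nonneg_iff] at this
    exact ⟨Complex.ext rfl this.2.symm, this.1⟩
  have hprod : ∀ k, w k ≠ 0 →
      (R k x₀ x₀).re * (R k x₂ x₂).re = (R k x₁ x₁).re ^ 2 := by
    intro k hk
    obtain ⟨S, ⟨i, hi⟩, ⟨j, hj⟩, σ, τ, hσ, hτ, h⟩ := hR k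
    rw [Finset.mem_compl] at hj
    have hij : i ≠ j := fun h => hj (h ▸ hi)
    -- Two places i and j on opposite sides of the cut are kept at 0, so that flipping them gives
    -- weights m + 1 and m + 2.
    have hcard : m ≤ ((Finset.univ.erase i).erase j).card := by
      rw [Finset.card_erase_of_mem (by simp [hij.symm]), Finset.card_erase_of_mem (by simp),
        Finset.card_univ]
      omega
    obtain ⟨x, hx, hx0⟩ := exists_wt_eq _ hcard
    have hxi : x i = 0 := hx0 i (by simp)
    have hxj : x j = 0 := hx0 j (by simp)
    have hxij : Function.update x i 1 j = 0 := by
      rw [Function.update_of_ne hij.symm, hxj]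
    have key := tensorAcross_diag_mul S σ τ hi hj x
    rw [← h, hinv k hk x x₀ (by omega),
      hinv k hk (Function.update x i 1) x₁ (by rw [wt_update_zero hxi]; omega),
      hinv k hk (Function.update x j 1) x₁ (by rw [wt_update_zero hxj]; omega),
      hinv k hk (Function.update (Function.update x i 1) j 1) x₂
        (by rw [wt_update_zero hxij, wt_update_zero hxi]; omega),
      (hdiag k x₀).1, (hdiag k x₁).1, (hdiag k x₂).1] at key
    rw [sq]
    exact_mod_cast key
  simp only [Matrix.sum_apply, Matrix.smul_apply, Complex.re_sum, Complex.smul_re, smul_eq_mul]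
  -- Cauchy–Schwarz over the mixture, from the termwise equality.
  refine Finset.sum_sq_le_sum_mul_sum_of_sq_le_mul _
    (fun k _ => mul_nonneg (hw k) (hdiag k x₀).2) (fun k _ => mul_nonneg (hw k) (hdiag k x₂).2)
    fun k _ => ?_
  by_cases hk : w k = 0
  · simp [hk]
  · rw [mul_pow, ← hprod k hk]
    exact le_of_eq (by ring)

/-! ### Symmetric pure states and their reductions -/

theorem pureState_comp_wt_symm (f : ℕ → ℂ) (x y : ι → Fin 2) (h : wt x = wt y) :
    pureState (fun z : ι → Fin 2 => f (wt z)) x x + pureState (fun z => f (wt z)) y y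
      - pureState (fun z => f (wt z)) x y - pureState (fun z => f (wt z)) y x = 0 := by
  simp [pureState, h]

theorem partialTrace_pureState_comp_wt (J : Finset ι) (f : ℕ → ℂ) (x y : {i // i ∉ J} → Fin 2) :
    partialTrace J (pureState fun z => f (wt z)) x y =
      (∑ j ∈ Finset.range (J.card + 1),
        (J.card.choose j : ℂ) * (f (wt x + j) * star (f (wt y + j)))) /
        ((∑ z : ι → Fin 2, ‖f (wt z)‖ ^ 2 : ℝ) : ℂ) := by
  simp only [partialTrace, pureState, Matrix.of_apply, wt_glue]
  rw [← Finset.sum_div, sum_comp_wt (fun j => f (wt x + j) * star (f (wt y + j)))]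
  simp [Fintype.card_coe]

/-- The symmetric operator that is diagonal in the Dicke basis. -/
def dickeDiagonal (ι : Type*) [Fintype ι] (p : ℕ → ℝ) : QOp ι :=
  Matrix.of fun x y => if wt x = wt y then (p (wt x) : ℂ) else 0

/-- If the weights in the support of `f` are more than `n` apart, then the reduction to `n`
particles is diagonal in the Dicke basis. -/
theorem partialTrace_pureState_eq_dickeDiagonal (J : Finset ι) (f : ℕ → ℂ)
    (hf : ∀ k l, k < l → l ≤ k + Fintype.card {i // i ∉ J} → f k = 0 ∨ f l = 0) :
    partialTrace J (pureState fun z => f (wt z)) = dickeDiagonal {i // i ∉ J} fun k =>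
      (∑ j ∈ Finset.range (J.card + 1), (J.card.choose j : ℝ) * ‖f (k + j)‖ ^ 2) /
        ∑ z : ι → Fin 2, ‖f (wt z)‖ ^ 2 := by
  ext x y
  rw [partialTrace_pureState_comp_wt]
  simp only [dickeDiagonal, Matrix.of_apply]
  have hx := wt_le_card x
  have hy := wt_le_card y
  split_ifs with h
  · rw [← h]
    push_cast
    congr 1
    exact Finset.sum_congr rfl fun j _ => by rw [← Complex.mul_conj']; rfl
  · rw [Finset.sum_eq_zero, zero_div]
    intro j _
    rcases lt_or_gt_of_ne h with h | h
    · rcases hf (wt x + j) (wt y + j) (by omega) (by omega) with h | h <;> simp [h]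
    · rcases hf (wt y + j) (wt x + j) (by omega) (by omega) with h | h <;> simp [h]

theorem dickeDiagonal_symm (p : ℕ → ℝ) (x y : ι → Fin 2) (h : wt x = wt y) :
    dickeDiagonal ι p x x + dickeDiagonal ι p y y
      - dickeDiagonal ι p x y - dickeDiagonal ι p y x = 0 := by
  simp [dickeDiagonal, h]

theorem dickeDiagonal_not_biseparable {p : ℕ → ℝ} {m : ℕ} (hm : m + 2 ≤ Fintype.card ι)
    (hp : p m * p (m + 2) < p (m + 1) ^ 2) : ¬ Biseparable (dickeDiagonal ι p) := by
  intro h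
  obtain ⟨x₀, h₀, -⟩ := exists_wt_eq (ι := ι) (k := m) Finset.univ
    (by rw [Finset.card_univ]; omega)
  obtain ⟨x₁, h₁, -⟩ := exists_wt_eq (ι := ι) (k := m + 1) Finset.univ
    (by rw [Finset.card_univ]; omega)
  obtain ⟨x₂, h₂, -⟩ := exists_wt_eq (ι := ι) (k := m + 2) Finset.univ
    (by rw [Finset.card_univ]; omega)
  have := h.diag_sq_le (dickeDiagonal_symm p) hm h₀ h₁ h₂
  simp only [dickeDiagonal, Matrix.of_apply, if_true, Complex.ofReal_re, h₀, h₁, h₂] at this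
  exact absurd this (not_le.2 hp)

/-! ### Full separability of states that are diagonal in the Dicke basis -/

/-- Nonnegative multiples of fully separable states. -/
def SeparableCone (R : QOp ι) : Prop := ∃ c : ℝ, 0 ≤ c ∧ ∃ P, FullySeparable P ∧ R = c • P

theorem productStates_trace {P : QOp ι} (hP : P ∈ productStates ι) : P.trace = 1 := by
  obtain ⟨v, hv, rfl⟩ := hP
  simp only [Matrix.trace, Matrix.diag, Matrix.of_apply, productVec, star_prod,
    ← Finset.prod_mul_distrib]
  rw [← Fintype.prod_sum (fun i s => v i s * star (v i s))]
  refine Finset.prod_eq_one fun i _ => ?_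
  have := hv i
  have h2 : ((∑ s, ‖v i s‖ ^ 2 : ℝ) : ℂ) = 1 := by rw [this]; simp
  rw [← h2]
  push_cast
  exact Finset.sum_congr rfl fun s _ => Complex.mul_conj' _

/-- This lets one work in the cone and recover the normalization from the trace at the end. -/
theorem FullySeparable.trace_eq_one {P : QOp ι} (hP : FullySeparable P) : P.trace = 1 := by
  obtain ⟨κ, _, w, R, -, hw, hR, rfl⟩ := mem_convexHull_iff_exists_fintype.1 hP
  simp only [Matrix.trace_sum, Matrix.trace_smul, productStates_trace (hR _)]
  rw [← Finset.sum_smul, hw, one_smul]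

theorem SeparableCone.fullySeparable {R : QOp ι} (hR : SeparableCone R) (h : R.trace = 1) :
    FullySeparable R := by
  obtain ⟨c, -, P, hP, rfl⟩ := hR
  rw [Matrix.trace_smul, hP.trace_eq_one] at h
  have : c = 1 := by simpa using congrArg Complex.re h
  rwa [this, one_smul]

theorem SeparableCone.smul {R : QOp ι} (hR : SeparableCone R) {c : ℝ} (hc : 0 ≤ c) :
    SeparableCone (c • R) := by
  obtain ⟨d, hd, P, hP, rfl⟩ := hR
  exact ⟨c * d, mul_nonneg hc hd, P, hP, smul_smul _ _ _⟩

theorem SeparableCone.add {R R' : QOp ι} (hR : SeparableCone R) (hR' : SeparableCone R') :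
    SeparableCone (R + R') := by
  obtain ⟨c, hc, P, hP, rfl⟩ := hR
  obtain ⟨d, hd, Q, hQ, rfl⟩ := hR'
  rcases (add_nonneg hc hd).eq_or_lt with h | h
  · obtain rfl : c = 0 := by linarith
    obtain rfl : d = 0 := by linarith
    exact ⟨0, le_rfl, P, hP, by simp⟩
  · refine ⟨c + d, h.le, (c / (c + d)) • P + (d / (c + d)) • Q,
      convex_convexHull ℝ _ hP hQ (by positivity) (by positivity) (by field_simp), ?_⟩
    rw [smul_add, smul_smul, smul_smul, mul_div_cancel₀ _ h.ne', mul_div_cancel₀ _ h.ne']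

theorem SeparableCone.sum {κ : Type*} {s : Finset κ} (hs : s.Nonempty) {R : κ → QOp ι}
    (hR : ∀ k ∈ s, SeparableCone (R k)) : SeparableCone (∑ k ∈ s, R k) :=
  Finset.sum_induction_nonempty R _ (fun _ _ => SeparableCone.add) hs hR

/-- The unnormalized projector onto `v ⊗ ⋯ ⊗ v`. -/
noncomputable def powerProjector (ι : Type*) [Fintype ι] (v : Fin 2 → ℂ) : QOp ι :=
  Matrix.of fun x y => productVec (fun _ => v) x * star (productVec (fun _ => v) y)

theorem separableCone_powerProjector {v : Fin 2 → ℂ} (hv : v ≠ 0) :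
    SeparableCone (powerProjector ι v) := by
  have hM : 0 < ∑ s, ‖v s‖ ^ 2 := by
    obtain ⟨s, hs⟩ := Function.ne_iff.1 hv
    exact Finset.sum_pos' (fun _ _ => by positivity)
      ⟨s, Finset.mem_univ s, by have := norm_pos_iff.2 hs; positivity⟩
  set M := ∑ s, ‖v s‖ ^ 2 with hMdef
  have hsq : ((√M : ℝ) : ℂ) ≠ 0 := by exact_mod_cast (Real.sqrt_pos.2 hM).ne'
  set u : Fin 2 → ℂ := fun s => v s / (√M : ℝ) with hu
  have hvu : ∀ s, v s = (√M : ℝ) * u s := fun s => by simp only [hu]; field_simp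
  refine ⟨M ^ Fintype.card ι, by positivity, powerProjector ι u,
    subset_convexHull ℝ _ ⟨fun _ => u, fun _ => ?_, rfl⟩, ?_⟩
  · simp only [hu, norm_div, div_pow, Complex.norm_real, Real.norm_eq_abs, sq_abs,
      Real.sq_sqrt hM.le]
    rw [← Finset.sum_div, ← hMdef, div_self hM.ne']
  · ext x y
    have hMM : (M : ℂ) = (√M : ℝ) * (√M : ℝ) := by
      rw [← Complex.ofReal_mul, Real.mul_self_sqrt hM.le]
    simp only [powerProjector, productVec, Matrix.of_apply, Matrix.smul_apply, hvu,
      Finset.prod_mul_distrib, Finset.prod_const, Finset.card_univ, Complex.real_smul,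
      Complex.ofReal_pow, star_mul', star_pow]
    rw [show star (((√M : ℝ) : ℂ)) = (√M : ℝ) from Complex.conj_ofReal _, hMM, mul_pow]
    ring

theorem productVec_const (v : Fin 2 → ℂ) (x : ι → Fin 2) :
    productVec (fun _ => v) x = v 1 ^ wt x * v 0 ^ (Fintype.card ι - wt x) := by
  have h : ∀ i, v (x i) = if x i = 1 then v 1 else v 0 := fun i => by
    generalize x i = s
    fin_cases s <;> simp
  simp only [productVec, h, Finset.prod_ite, Finset.prod_const]
  rw [← wt]
  congr 2
  rw [← Finset.card_univ, ← Finset.card_filter_add_card_filter_not (s := Finset.univ)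
    (fun i => x i = 1), ← wt]
  simp

theorem dickeDiagonal_add (p q : ℕ → ℝ) :
    dickeDiagonal ι (fun k => p k + q k) = dickeDiagonal ι p + dickeDiagonal ι q := by
  ext x y
  simp only [dickeDiagonal, Matrix.of_apply, Matrix.add_apply]
  split_ifs <;> simp

theorem dickeDiagonal_smul (c : ℝ) (p : ℕ → ℝ) :
    dickeDiagonal ι (fun k => c * p k) = c • dickeDiagonal ι p := by
  ext x y
  simp only [dickeDiagonal, Matrix.of_apply, Matrix.smul_apply]
  split_ifs <;> simp

theorem dickeDiagonal_congr {p q : ℕ → ℝ} (h : ∀ k ≤ Fintype.card ι, p k = q k) :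
    dickeDiagonal ι p = dickeDiagonal ι q := by
  ext x y
  simp only [dickeDiagonal, Matrix.of_apply, h _ (wt_le_card x)]

/-- Averaging the product states `(|0⟩ + √r ω |1⟩)^{⊗n}` over the roots of unity `ω`. -/
theorem separableCone_dickeDiagonal_pow {r : ℝ} (hr : 0 ≤ r) :
    SeparableCone (dickeDiagonal ι fun k => r ^ k) := by
  -- One more than the number of particles, so that all weights 0, …, n - 1 are distinct modulo n
  -- and the average kills every off-diagonal block.
  set n := Fintype.card ι + 1 with hn
  have hn0 : n ≠ 0 := by omega
  have hζ := Complex.isPrimitiveRoot_exp n hn0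
  set ζ := Complex.exp (2 * Real.pi * Complex.I / n)
  have hζ1 : ζ * star ζ = 1 := by
    rw [show star ζ = (starRingEnd ℂ) ζ from rfl, Complex.mul_conj', hζ.norm'_eq_one hn0]
    simp
  have key : dickeDiagonal ι (fun k => r ^ k) = (n : ℝ)⁻¹ •
      ∑ l ∈ Finset.range n, powerProjector ι ![1, (√r : ℝ) * ζ ^ l] := by
    ext x y
    have hx := wt_le_card x
    have hy := wt_le_card y
    have hr2 : ((√r : ℝ) : ℂ) * (√r : ℝ) = r := by
      rw [← Complex.ofReal_mul, Real.mul_self_sqrt hr]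
    have hterm : ∀ l, powerProjector ι ![1, (√r : ℝ) * ζ ^ l] x y =
        (((√r : ℝ) : ℂ) ^ wt x * ((√r : ℝ) : ℂ) ^ wt y) * (ζ ^ wt x * star ζ ^ wt y) ^ l := by
      intro l
      simp only [powerProjector, Matrix.of_apply, productVec_const, Matrix.cons_val_zero,
        Matrix.cons_val_one, one_pow, mul_one, mul_pow, star_mul', star_pow]
      rw [show star (((√r : ℝ) : ℂ)) = (√r : ℝ) from Complex.conj_ofReal _]
      ring
    simp only [Matrix.smul_apply, Matrix.sum_apply, hterm, ← Finset.mul_sum]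
    simp only [dickeDiagonal, Matrix.of_apply]
    have hnC : (n : ℂ) ≠ 0 := by exact_mod_cast hn0
    split_ifs with h
    · rw [← h, ← mul_pow, ← mul_pow, hr2, hζ1]
      simp only [one_pow, Finset.sum_const, Finset.card_range, Complex.real_smul]
      push_cast
      field_simp
      simp
    · have hμ : ζ ^ wt x * star ζ ^ wt y ≠ 1 := by
        intro h1
        apply h
        refine hζ.pow_inj (by omega) (by omega) ?_
        calc ζ ^ wt x = ζ ^ wt x * (ζ * star ζ) ^ wt y := by rw [hζ1]; simp
          _ = (ζ ^ wt x * star ζ ^ wt y) * ζ ^ wt y := by ring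
          _ = ζ ^ wt y := by rw [h1, one_mul]
      have hμn : (ζ ^ wt x * star ζ ^ wt y) ^ n = 1 := by
        rw [mul_pow, ← pow_mul, ← pow_mul, mul_comm _ n, mul_comm _ n, pow_mul, pow_mul,
          ← star_pow, hζ.pow_eq_one]
        simp
      have hg := geom_sum_eq hμ n
      rw [hg, hμn]
      simp
  rw [key]
  refine (SeparableCone.sum ⟨0, by simp [hn]⟩ fun l _ => ?_).smul (by positivity)
  exact separableCone_powerProjector fun h => by simpa using congrFun h 0

theorem separableCone_dickeDiagonal_zero :
    SeparableCone (dickeDiagonal ι fun k => if k = 0 then 1 else 0) := by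
  -- The case r = 0, with 0 ^ 0 = 1.
  have h := separableCone_dickeDiagonal_pow (ι := ι) le_rfl
  convert h using 3 with k
  split_ifs with hk <;> simp [hk]

theorem separableCone_dickeDiagonal_card :
    SeparableCone (dickeDiagonal ι fun k => if k = Fintype.card ι then 1 else 0) := by
  have h := separableCone_powerProjector (ι := ι) (v := ![0, 1])
    (fun h => by simpa using congrFun h 1)
  convert h using 1
  ext x y
  have hx := wt_le_card x
  have hy := wt_le_card y
  simp only [dickeDiagonal, powerProjector, Matrix.of_apply, productVec_const,
    Matrix.cons_val_zero, Matrix.cons_val_one, one_pow, one_mul, zero_pow_eq]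
  by_cases h1 : wt x = Fintype.card ι <;> by_cases h2 : wt y = Fintype.card ι
  · simp [h1, h2]
  · have : Fintype.card ι - wt y ≠ 0 := by omega
    simp [h1, this, Ne.symm h2]
  · have : Fintype.card ι - wt x ≠ 0 := by omega
    simp [h1, this]
  · have : Fintype.card ι - wt x ≠ 0 := by omega
    simp [h1, this]

/-- A state that is diagonal in the Dicke basis is fully separable if its spectrum is geometric
up to an excess at the two ends. -/
theorem fullySeparable_dickeDiagonal {p : ℕ → ℝ} {A r : ℝ} (hA : 0 ≤ A) (hr : 0 ≤ r)
    (hcard : 0 < Fintype.card ι) (h0 : A ≤ p 0)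
    (hmid : ∀ k, 0 < k → k < Fintype.card ι → p k = A * r ^ k)
    (hlast : A * r ^ Fintype.card ι ≤ p (Fintype.card ι))
    (htr : (dickeDiagonal ι p).trace = 1) : FullySeparable (dickeDiagonal ι p) := by
  refine SeparableCone.fullySeparable ?_ htr
  have h := (((separableCone_dickeDiagonal_pow (ι := ι) hr).smul hA).add
    ((separableCone_dickeDiagonal_zero (ι := ι)).smul (sub_nonneg.2 h0))).add
    ((separableCone_dickeDiagonal_card (ι := ι)).smul (sub_nonneg.2 hlast))
  simp only [← dickeDiagonal_smul, ← dickeDiagonal_add] at h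
  convert h using 1
  refine dickeDiagonal_congr fun k hk => ?_
  rcases Nat.eq_zero_or_pos k with rfl | hk0
  · simp [hcard.ne]
  · rcases hk.eq_or_lt with rfl | hk1
    · simp [hk0.ne']
    · simp [hk0.ne', hk1.ne, hmid k hk0 hk1]

end Symmetric

/-! ### The superposition of three Dicke states -/

/-- The amplitude of a basis vector with `k` particles in state `1`. -/
noncomputable def tripleAmplitude (N : ℕ) (α β γ : ℂ) (k : ℕ) : ℂ :=
  if k = 1 then α else if k = 7 then β else if k = N then γ else 0

theorem dicke_superposition_eq {N : ℕ} (hN : 13 ≤ N) (a b c : ℂ) :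
    a • dicke N 1 + b • dicke N 7 + c • dicke N N = fun x => tripleAmplitude N
      (a * ((1 / √(N : ℝ) : ℝ) : ℂ)) (b * ((1 / √(N.choose 7 : ℝ) : ℝ) : ℂ)) c (wt x) := by
  funext x
  simp only [Pi.add_apply, Pi.smul_apply, dicke, smul_eq_mul, tripleAmplitude]
  change a * (if wt x = 1 then _ else _) + b * (if wt x = 7 then _ else _) +
    c * (if wt x = N then _ else _) = _
  split_ifs <;> first | omega | simp

theorem tripleAmplitude_gap {N n : ℕ} (hN : 13 ≤ N) (hn : n ≤ 5) (α β γ : ℂ) (k l : ℕ)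
    (hkl : k < l) (hl : l ≤ k + n) :
    tripleAmplitude N α β γ k = 0 ∨ tripleAmplitude N α β γ l = 0 := by
  unfold tripleAmplitude
  split_ifs <;> first | omega | simp

/-- Each of the three weights is reached by a single j. The guard k ≤ 1 is needed because 1 - k is
truncated; the bound k ≤ 7 keeps 7 - k and N - k honest. -/
theorem sum_choose_mul_tripleAmplitude {N : ℕ} (hN : 13 ≤ N) (t : ℕ) (α β γ : ℂ) {k : ℕ}
    (hk : k ≤ 7) :
    ∑ j ∈ Finset.range (t + 1), (t.choose j : ℝ) * ‖tripleAmplitude N α β γ (k + j)‖ ^ 2 =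
      (if k ≤ 1 then (t.choose (1 - k) : ℝ) * ‖α‖ ^ 2 else 0) +
        t.choose (7 - k) * ‖β‖ ^ 2 + t.choose (N - k) * ‖γ‖ ^ 2 := by
  have hterm : ∀ j, (t.choose j : ℝ) * ‖tripleAmplitude N α β γ (k + j)‖ ^ 2 =
      (if k ≤ 1 then if j = 1 - k then (t.choose (1 - k) : ℝ) * ‖α‖ ^ 2 else 0 else 0) +
      (if j = 7 - k then (t.choose (7 - k) : ℝ) * ‖β‖ ^ 2 else 0) +
      (if j = N - k then (t.choose (N - k) : ℝ) * ‖γ‖ ^ 2 else 0) := by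
    intro j
    unfold tripleAmplitude
    by_cases h1 : k + j = 1
    · obtain rfl : j = 1 - k := by omega
      rw [if_pos h1, if_pos (by omega : k ≤ 1), if_pos rfl,
        if_neg (by omega : ¬ (1 - k = 7 - k)), if_neg (by omega : ¬ (1 - k = N - k))]
      ring
    have h1' : k ≤ 1 → ¬ (j = 1 - k) := by omega
    have h1'' : (if k ≤ 1 then if j = 1 - k then (t.choose (1 - k) : ℝ) * ‖α‖ ^ 2 else 0
        else 0) = 0 := by
      split_ifs <;> first | rfl | exact absurd ‹_› (h1' ‹_›)
    rw [h1'', if_neg h1]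
    by_cases h7 : k + j = 7
    · obtain rfl : j = 7 - k := by omega
      rw [if_pos h7, if_neg (by omega : ¬ (7 - k = N - k)), if_pos rfl]
      ring
    by_cases hN' : k + j = N
    · obtain rfl : j = N - k := by omega
      rw [if_neg h7, if_pos hN', if_neg (by omega : ¬ (N - k = 7 - k)), if_pos rfl]
      ring
    · rw [if_neg h7, if_neg hN', if_neg (by omega : ¬ (j = 7 - k)),
        if_neg (by omega : ¬ (j = N - k)), norm_zero]
      ring
  have hsum : ∀ m (q : ℝ), ∑ j ∈ Finset.range (t + 1),
      (if j = m then (t.choose m : ℝ) * q else 0) = t.choose m * q := by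
    intro m q
    rw [Finset.sum_ite_eq']
    split_ifs with h
    · rfl
    · rw [Finset.mem_range] at h
      rw [Nat.choose_eq_zero_of_lt (by omega)]
      simp
  simp only [hterm, Finset.sum_add_distrib, hsum]
  congr 2
  split_ifs
  · exact hsum _ _
  · simp

/-! ### Binomial identities and inequalities. -/

theorem choose_succ_mul_real {M k : ℕ} (h : k ≤ M) :
    (M.choose (k + 1) : ℝ) * (k + 1) = M.choose k * ((M : ℝ) - k) := by
  have := Nat.choose_succ_right_eq M k
  rw [← Nat.cast_sub h]
  exact_mod_cast this


theorem choose_three_mul_choose_five_lt {n : ℕ} (hn : 4 ≤ n) :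
    (n.choose 3 : ℝ) * n.choose 5 < (n.choose 4 : ℝ) ^ 2 := by
  have e4 := choose_succ_mul_real hn
  have e3 := choose_succ_mul_real (M := n) (k := 3) (by omega)
  have hpos : (0 : ℝ) < n.choose 4 := by exact_mod_cast Nat.choose_pos hn
  have hpos' : (0 : ℝ) < n.choose 3 := by exact_mod_cast Nat.choose_pos (by omega : 3 ≤ n)
  have hn' : (4 : ℝ) ≤ n := by exact_mod_cast hn
  norm_num at e3 e4
  generalize (n.choose 3 : ℝ) = c3 at *
  generalize (n.choose 4 : ℝ) = c4 at *
  generalize (n.choose 5 : ℝ) = c5 at *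
  have h : c3 * c5 * 20 = c4 ^ 2 * 20 - c3 * c4 * (n + 1) := by
    linear_combination 4 * c3 * e4 - 5 * c4 * e3
  have : 0 < c3 * c4 * ((n : ℝ) + 1) := by positivity
  linarith

/-- The spectrum of the four-particle reduction, in units of `‖β‖² / ⟨ψ|ψ⟩`. -/
theorem reduced_spectrum {n : ℕ} (hn : 9 ≤ n) {r A s : ℝ} (hr : r = 5 / ((n : ℝ) - 4))
    (hA : A = n.choose 4 * (((n : ℝ) - 4) / 5) ^ 3)
    (hs : s = n.choose 5 * ((n : ℝ) + 1) / 30) :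
    0 ≤ r ∧ 0 ≤ A ∧ A ≤ n * s + n.choose 7 ∧ s + n.choose 6 = A * r ∧
      (n.choose 5 : ℝ) = A * r ^ 2 ∧ (n.choose 4 : ℝ) = A * r ^ 3 ∧
      A * r ^ 4 ≤ n.choose 4 := by
  have e4 := choose_succ_mul_real (M := n) (k := 4) (by omega)
  have e5 := choose_succ_mul_real (M := n) (k := 5) (by omega)
  have e6 := choose_succ_mul_real (M := n) (k := 6) (by omega)
  have hpos : (0 : ℝ) ≤ n.choose 4 := by positivity
  have hn' : (9 : ℝ) ≤ n := by exact_mod_cast hn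
  norm_num at e4 e5 e6
  generalize (n.choose 4 : ℝ) = c4 at *
  generalize (n.choose 5 : ℝ) = c5 at *
  generalize (n.choose 6 : ℝ) = c6 at *
  generalize (n.choose 7 : ℝ) = c7 at *
  -- With m = n - 4 all the binomials become polynomials in m times `n.choose 4`, and r = 5 / m ≤ 1.
  obtain ⟨m, hm, hmn⟩ : ∃ m : ℝ, 5 ≤ m ∧ (n : ℝ) = m + 4 := ⟨n - 4, by linarith, by ring⟩
  rw [hmn] at e4 e5 e6 hr hA hs ⊢
  obtain rfl : c5 = c4 * m / 5 := by linarith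
  obtain rfl : c6 = c4 * m / 5 * (m - 1) / 6 := by linarith
  obtain rfl : c7 = c4 * m / 5 * (m - 1) / 6 * (m - 2) / 7 := by linarith
  have hm0 : 0 < m := by linarith
  rw [add_sub_cancel_right] at hr hA
  subst hr hA hs
  refine ⟨by positivity, by positivity, ?_, ?_, ?_, ?_, ?_⟩
  -- After division by c4 * m the difference of the two sides is a quadratic in m with positive
  -- coefficients.
  · have hq : 0 ≤ c4 * m := by positivity
    nlinarith [mul_nonneg hq hm0.le, mul_nonneg hq (mul_nonneg hm0.le hm0.le)]
  · field_simp
    ring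
  · field_simp
  · field_simp
  · have h : c4 * (m / 5) ^ 3 * (5 / m) ^ 4 = c4 * (5 / m) := by field_simp
    rw [h]
    exact mul_le_of_le_one_right hpos (by rw [div_le_one hm0]; exact hm)

/-! ### The three resistance conditions for the superposition. -/

section Resistance

variable {N : ℕ} {α β γ : ℂ}

theorem tripleAmplitude_ne_zero (hN : 13 ≤ N) (hβ : β ≠ 0) :
    (fun x : Fin N → Fin 2 => tripleAmplitude N α β γ (wt x)) ≠ 0 := by
  obtain ⟨x, hx, -⟩ := exists_wt_eq (ι := Fin N) (k := 7) Finset.univ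
    (by rw [Finset.card_univ, Fintype.card_fin]; omega)
  intro h
  have h' := congrFun h x
  rw [hx] at h'
  exact hβ (by simpa [tripleAmplitude] using h')

theorem norm_sq_pos {ι : Type*} [Fintype ι] [DecidableEq ι] {ψ : QVec ι} (hψ : ψ ≠ 0) :
    0 < ∑ z, ‖ψ z‖ ^ 2 := by
  obtain ⟨x, hx⟩ := Function.ne_iff.1 hψ
  exact Finset.sum_pos' (fun _ _ => by positivity)
    ⟨x, Finset.mem_univ _, by have := norm_pos_iff.2 hx; positivity⟩

theorem pureState_triple_not_biseparable (hN : 13 ≤ N) (hβ : β ≠ 0) :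
    ¬ Biseparable (pureState fun x : Fin N → Fin 2 => tripleAmplitude N α β γ (wt x)) := by
  intro h
  have hcard : ∀ k ≤ 8, k ≤ (Finset.univ : Finset (Fin N)).card := fun k hk => by
    rw [Finset.card_univ, Fintype.card_fin]; omega
  obtain ⟨x₆, h₆, -⟩ := exists_wt_eq Finset.univ (hcard 6 (by norm_num))
  obtain ⟨x₇, h₇, -⟩ := exists_wt_eq Finset.univ (hcard 7 (by norm_num))
  obtain ⟨x₈, h₈, -⟩ := exists_wt_eq Finset.univ (hcard 8 (by norm_num))
  have key := h.diag_sq_le (pureState_comp_wt_symm _)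
    (by rw [Fintype.card_fin]; omega) h₆ h₇ h₈
  have f6 : tripleAmplitude N α β γ 6 = 0 := by
    unfold tripleAmplitude
    split_ifs <;> first | omega | rfl
  have f7 : tripleAmplitude N α β γ 7 = β := by simp [tripleAmplitude]
  have hZ := norm_sq_pos (tripleAmplitude_ne_zero (α := α) (γ := γ) hN hβ)
  simp only [pureState, Matrix.of_apply, h₆, h₇, f6, f7, zero_mul, zero_div,
    Complex.zero_re] at key
  generalize ∑ z : Fin N → Fin 2, ‖tripleAmplitude N α β γ (wt z)‖ ^ 2 = Z at key hZ
  rw [show β * star β = _ from Complex.mul_conj' β, ← Complex.ofReal_pow, ← Complex.ofReal_div,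
    Complex.ofReal_re] at key
  have hβ' := norm_pos_iff.2 hβ
  have hp : 0 < (‖β‖ ^ 2 / Z) ^ 2 := by positivity
  exact absurd key (not_le.2 hp)

theorem card_notMem_eq (J : Finset (Fin N)) {n : ℕ} (hn : n ≤ N) (hJ : J.card = N - n) :
    Fintype.card {i // i ∉ J} = n := by
  rw [Fintype.card_subtype_compl, Fintype.card_coe, Fintype.card_fin]
  omega

theorem partialTrace_triple_not_biseparable (hN : 13 ≤ N) (hβ : β ≠ 0) (J : Finset (Fin N))
    (hJ : J.card = N - 5) :
    ¬ Biseparable (partialTrace J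
      (pureState fun x : Fin N → Fin 2 => tripleAmplitude N α β γ (wt x))) := by
  have hcard := card_notMem_eq J (by omega) hJ
  have hZ := norm_sq_pos (tripleAmplitude_ne_zero (α := α) (γ := γ) hN hβ)
  rw [partialTrace_pureState_eq_dickeDiagonal J _ (tripleAmplitude_gap hN hcard.le α β γ)]
  -- At weights 2, 3, 4 only the β component contributes: α needs k ≤ 1, and γ needs k = 5.
  refine dickeDiagonal_not_biseparable (m := 2) (by omega) ?_
  generalize ∑ z : Fin N → Fin 2, ‖tripleAmplitude N α β γ (wt z)‖ ^ 2 = Z at hZ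
  have hspec : ∀ k, 2 ≤ k → k ≤ 4 → ∑ j ∈ Finset.range (J.card + 1),
      (J.card.choose j : ℝ) * ‖tripleAmplitude N α β γ (k + j)‖ ^ 2 =
        (N - 5).choose (7 - k) * ‖β‖ ^ 2 := by
    intro k hk2 hk4
    rw [sum_choose_mul_tripleAmplitude hN _ α β γ (by omega), hJ, if_neg (by omega),
      Nat.choose_eq_zero_of_lt (by omega : N - 5 < N - k)]
    simp
  rw [hspec 2 le_rfl (by norm_num), hspec (2 + 1) (by norm_num) (by norm_num),
    hspec (2 + 2) (by norm_num) le_rfl]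
  have hc := choose_three_mul_choose_five_lt (n := N - 5) (by omega)
  simp only [Nat.reduceSub, Nat.reduceAdd]
  have hβ' := norm_pos_iff.2 hβ
  have hq : 0 < (‖β‖ ^ 2 / Z) ^ 2 := by positivity
  calc _ = (((N - 5).choose 3 : ℝ) * (N - 5).choose 5) * (‖β‖ ^ 2 / Z) ^ 2 := by ring
    _ < ((N - 5).choose 4 : ℝ) ^ 2 * (‖β‖ ^ 2 / Z) ^ 2 := by gcongr
    _ = _ := by ring

/-- The value of ‖α‖² solves p 1 * p 3 = p 2 ^ 2, and the bound on ‖γ‖² suffices at the top end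
because the ratio r is at most 1. -/
theorem partialTrace_triple_fullySeparable (hN : 13 ≤ N) (hβ : β ≠ 0)
    (hα : ‖α‖ ^ 2 = (N - 4).choose 5 * ((N : ℝ) - 3) / 30 * ‖β‖ ^ 2)
    (hγ : ((N - 4).choose 4 : ℝ) * ‖β‖ ^ 2 ≤ ‖γ‖ ^ 2) (J : Finset (Fin N))
    (hJ : J.card = N - 4) :
    FullySeparable (partialTrace J
      (pureState fun x : Fin N → Fin 2 => tripleAmplitude N α β γ (wt x))) := by
  have hcard := card_notMem_eq J (by omega) hJ
  have hψ := tripleAmplitude_ne_zero (α := α) (γ := γ) hN hβ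
  have htr := (isDensity_partialTrace J (isDensity_pureState hψ)).2
  have hZ := norm_sq_pos hψ
  rw [partialTrace_pureState_eq_dickeDiagonal J _
    (tripleAmplitude_gap hN (by omega) α β γ)] at htr ⊢
  generalize ∑ z : Fin N → Fin 2, ‖tripleAmplitude N α β γ (wt z)‖ ^ 2 = Z at hZ htr ⊢
  have hspec : ∀ k, k ≤ 4 → ∑ j ∈ Finset.range (J.card + 1),
      (J.card.choose j : ℝ) * ‖tripleAmplitude N α β γ (k + j)‖ ^ 2 =
        (if k ≤ 1 then ((N - 4).choose (1 - k) : ℝ) * ‖α‖ ^ 2 else 0) +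
          (N - 4).choose (7 - k) * ‖β‖ ^ 2 + (N - 4).choose (N - k) * ‖γ‖ ^ 2 := by
    intro k hk
    rw [sum_choose_mul_tripleAmplitude hN _ α β γ (by omega), hJ]
  -- With N - 4 particles lost, the all-ones component reaches only weight 4.
  have hlow : ∀ k, k < 4 → ((N - 4).choose (N - k) : ℝ) = 0 := fun k hk => by
    rw [Nat.choose_eq_zero_of_lt (by omega), Nat.cast_zero]
  have hB : 0 ≤ ‖β‖ ^ 2 / Z := by positivity
  have hcast : ((N - 4 : ℕ) : ℝ) = N - 4 := by
    rw [Nat.cast_sub (by omega)]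
    norm_num
  obtain ⟨hr, hA, h0, h1, h2, h3, h4⟩ := reduced_spectrum (n := N - 4) (by omega) rfl rfl rfl
  have hs : ‖α‖ ^ 2 =
      ((N - 4).choose 5 * (((N - 4 : ℕ) : ℝ) + 1) / 30) * ‖β‖ ^ 2 := by
    rw [hα, hcast]
    ring
  generalize ((N - 4).choose 5 * (((N - 4 : ℕ) : ℝ) + 1) / 30 : ℝ) = s at *
  generalize 5 / (((N - 4 : ℕ) : ℝ) - 4) = r at *
  generalize ((N - 4).choose 4 * ((((N - 4 : ℕ) : ℝ) - 4) / 5) ^ 3 : ℝ) = A at *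
  refine fullySeparable_dickeDiagonal (mul_nonneg hA hB) hr (by omega) ?_ ?_ ?_ htr
  · rw [hspec 0 (by norm_num), hlow 0 (by norm_num), if_pos (by norm_num), Nat.sub_zero,
      Nat.choose_one_right, hs, mul_div_assoc']
    refine div_le_div_of_nonneg_right ?_ hZ.le
    nlinarith [mul_le_mul_of_nonneg_right h0 (sq_nonneg ‖β‖)]
  · intro k hk0 hk4
    rw [hcard] at hk4
    rw [hspec k hk4.le, hlow k hk4]
    interval_cases k
    · rw [if_pos le_rfl, Nat.sub_self, Nat.choose_zero_right, hs]
      linear_combination (‖β‖ ^ 2 / Z) * h1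
    · rw [if_neg (by norm_num)]
      linear_combination (‖β‖ ^ 2 / Z) * h2
    · rw [if_neg (by norm_num)]
      linear_combination (‖β‖ ^ 2 / Z) * h3
  · rw [hcard, hspec 4 le_rfl, if_neg (by norm_num), Nat.choose_self, Nat.cast_one, one_mul]
    rw [mul_div_assoc', div_mul_eq_mul_div]
    refine div_le_div_of_nonneg_right ?_ hZ.le
    have h5 : 0 ≤ ((N - 4).choose (7 - 4) : ℝ) * ‖β‖ ^ 2 := by positivity
    nlinarith [mul_le_mul_of_nonneg_right h4 (sq_nonneg ‖β‖)]

end Resistance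

end QubitStates

open QubitStates in
theorem mainTheorem5 (N : ℕ) (hN : 13 ≤ N) :
    ∃ K : ℝ, 0 < K ∧ ∀ a b c : ℂ, b ≠ 0 →
      ‖a‖ ^ 2 = (((N - 4).choose 5 : ℝ) * (N : ℝ) * ((N : ℝ) - 3)) /
        (30 * (N.choose 7 : ℝ)) * ‖b‖ ^ 2 →
      K * max ‖a‖ ‖b‖ ≤ ‖c‖ →
      QubitStates.StrongResistant (N - 5)
        (a • QubitStates.dicke N 1 + b • QubitStates.dicke N 7 + c • QubitStates.dicke N N) := by
  -- With C = `(N - 4).choose 4`, the requirement is C * ‖β‖² ≤ ‖c‖²; C + 1 avoids a square root, as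
  -- C ≤ (C + 1)².
  refine ⟨(N - 4).choose 4 + 1, by positivity, fun a b c hb ha hc => ?_⟩
  rw [dicke_superposition_eq hN]
  have hnorm : ∀ (z : ℂ) {q : ℝ}, 0 ≤ q → ‖z * ((1 / √q : ℝ) : ℂ)‖ ^ 2 = ‖z‖ ^ 2 / q := by
    intro z q hq
    rw [norm_mul, Complex.norm_real, mul_pow, Real.norm_eq_abs, sq_abs, div_pow,
      Real.sq_sqrt hq, one_pow, mul_one_div]
  have hα := hnorm a (Nat.cast_nonneg N)
  have hβ := hnorm b (Nat.cast_nonneg (N.choose 7))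
  have hNpos : (0 : ℝ) < N := by exact_mod_cast (by omega : 0 < N)
  have hC : (1 : ℝ) ≤ N.choose 7 := by exact_mod_cast Nat.choose_pos (by omega : 7 ≤ N)
  have hβ0 : b * ((1 / √(N.choose 7 : ℝ) : ℝ) : ℂ) ≠ 0 := by
    refine mul_ne_zero hb ?_
    have : 0 < 1 / √(N.choose 7 : ℝ) := by positivity
    exact_mod_cast this.ne'
  generalize a * ((1 / √(N : ℝ) : ℝ) : ℂ) = α at *
  generalize b * ((1 / √(N.choose 7 : ℝ) : ℝ) : ℂ) = β at *
  have hdens := isDensity_pureState (tripleAmplitude_ne_zero (α := α) (γ := c) hN hβ0)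
  refine ⟨⟨hdens, pureState_triple_not_biseparable hN hβ0⟩, fun J hJ =>
    ⟨isDensity_partialTrace J hdens, partialTrace_triple_not_biseparable hN hβ0 J hJ⟩,
    fun J hJ => partialTrace_triple_fullySeparable hN hβ0 ?_ ?_ J (by omega)⟩
  · rw [hα, hβ, ha]
    field_simp
  · have h1 : (((N - 4).choose 4 : ℝ) + 1) * ‖b‖ ≤ ‖c‖ :=
      le_trans (by gcongr; exact le_max_right _ _) hc
    have h2 : ‖β‖ ^ 2 ≤ ‖b‖ ^ 2 := by
      rw [hβ]
      exact div_le_self (by positivity) hC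
    have h3 : (0 : ℝ) ≤ (N - 4).choose 4 := by positivity
    calc ((N - 4).choose 4 : ℝ) * ‖β‖ ^ 2 ≤ (((N - 4).choose 4 : ℝ) + 1) ^ 2 * ‖b‖ ^ 2 := by
          refine mul_le_mul ?_ h2 (by positivity) (by positivity)
          nlinarith
      _ = ((((N - 4).choose 4 : ℝ) + 1) * ‖b‖) ^ 2 := by ring
      _ ≤ ‖c‖ ^ 2 := by gcongr
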